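/- A geometric graph is a finite simple graph drawn in the plane with straight-line edges, where the vertices are distinct points, no three of them collinear, and the drawing is noncrossing (two distinct edges share no point other than a common end vertex). A compatible matching of a geometric graph $G$ is a matching $M$ on the vertex set of $G$, with straight-line edges, such that $M$ contains no edge of $G$ and $G+M$ is noncrossing; it is maximal if it is not properly contained in another compatible matching of $G$. Its size is its number of edges. (a) For all integers $n, m$ with $n\ge 5$, $\frac{7n+95}{10}\le m\le 2n+2$ and $m\le 3n-7$, there is a geometric graph with $n$ vertices and $m$ edges that has a maximal compatible matching of size $\left\lceil\frac{2n-m+3}{13}\right\rceil$. (The condition $m\le 3n-7$ only excludes the pairs $(n,m)=(6,14),(7,15),(7,16),(8,18)$.) (b) Let $\mathrm{mm}(G)$ be the minimum size of a maximal compatible matching of $G$, and let $$\mathrm{mm}(d)=\liminf_{n\to\infty}\ \min\{\mathrm{mm}(G)/n \mid G \text{ a geometric graph with } n \text{ vertices and at most } dn \text{ edges}\}.$$ Then $\mathrm{mm}(d)\le \frac{2-d}{13}$ for every real $d$ with $\frac{7}{10}<d<2$. -/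

import Mathlib

open Filter

/-- A straight-line drawing of the graph `H`, with vertex `v` placed at the point `p v` of the
plane, is noncrossing if two distinct edges share no point other than a common end vertex. -/
def IsNoncrossing {V : Type*} (H : SimpleGraph V) (p : V → ℝ × ℝ) : Prop :=
  ∀ a b c d : V, H.Adj a b → H.Adj c d → s(a, b) ≠ s(c, d) →
    segment ℝ (p a) (p b) ∩ segment ℝ (p c) (p d) ⊆ p '' ({a, b} ∩ {c, d})

/-- A (noncrossing) geometric graph: a graph drawn in the plane with straight-line edges,
without crossings, whose vertices are in general position. (The plane is `ℝ × ℝ`; only its affine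
structure is used.) -/
structure GeometricGraph (V : Type*) where
  graph : SimpleGraph V
  pos : V → ℝ × ℝ
  pos_injective : Function.Injective pos
  general_position : ∀ u v w : V, u ≠ v → u ≠ w → v ≠ w →
    ¬ Collinear ℝ {pos u, pos v, pos w}
  noncrossing : IsNoncrossing graph pos

namespace GeometricGraph

variable {V : Type*}

/-- The number of edges. -/
noncomputable def numEdges (G : GeometricGraph V) : ℕ := G.graph.edgeSet.ncard

/-- `M` is a matching on the vertices of `G` (every vertex has at most one `M`-neighbour; a
matching is represented by the graph formed by its edges) that uses no edge of `G` and such that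
no two edges cross in `G + M`, drawn with straight-line edges. -/
structure IsCompatibleMatching (G : GeometricGraph V) (M : SimpleGraph V) : Prop where
  matching : ∀ a b c : V, M.Adj a b → M.Adj a c → b = c
  disjoint : Disjoint G.graph M
  noncrossing : IsNoncrossing (G.graph ⊔ M) G.pos

/-- A compatible matching that is contained in no other compatible matching. -/
def IsMaximalCompatibleMatching (G : GeometricGraph V) (M : SimpleGraph V) : Prop :=
  Maximal G.IsCompatibleMatching M

/-- A finite geometric graph has a maximal compatible matching, so that `mm` below is the minimum
of a nonempty set of natural numbers. -/
theorem exists_isMaximalCompatibleMatching [Finite V] (G : GeometricGraph V) :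
    ∃ M : SimpleGraph V, G.IsMaximalCompatibleMatching M := by
  have h : G.IsCompatibleMatching ⊥ :=
    ⟨fun _ _ _ h => h.elim, disjoint_bot_right, by simpa using G.noncrossing⟩
  obtain ⟨M, -, hM⟩ := (Set.toFinite {M | G.IsCompatibleMatching M}).exists_le_maximal h
  exact ⟨M, hM⟩

/-- `mm(G)`, the smallest size of a maximal compatible matching of `G`. -/
noncomputable def mm (G : GeometricGraph V) : ℕ :=
  sInf {k : ℕ | ∃ M : SimpleGraph V, G.IsMaximalCompatibleMatching M ∧ M.edgeSet.ncard = k}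

/-- The family of all geometric graphs with `n` vertices and at most `d n` edges. -/
def family (d : ℝ) (n : ℕ) : Set (GeometricGraph (Fin n)) :=
  {G | (G.numEdges : ℝ) ≤ d * n}

/-- `mm(d) = liminf_{n → ∞} min {mm(G) / n | G ∈ family d n}`. The infimum and the limit inferior
are taken in the complete lattice of extended reals. -/
noncomputable def mmDensity (d : ℝ) : EReal :=
  liminf (fun n : ℕ => ⨅ G ∈ family d n, (((G.mm : ℝ) / n : ℝ) : EReal)) atTop

end GeometricGraph

/-! A configuration separates forced edges `G` from optional ones, the edges of `T` outside `G` and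
`M`. If any two vertices missed by `M` are adjacent in `G`, or joined by a segment that meets an
edge of `G` or `M` ending in neither of them, then `M` is maximal, and it stays maximal when
optional edges are added. So one configuration serves every m from |G| to |T| - |M|
(`HasConfig.exists_geometricGraph`).

The economical uncovered part is an adjacent pair hidden behind a wall: an edge `p q` of `G` or `M`
between covered vertices. Points close enough to the midpoint of `p q` see the other side only
through `p q` (`exists_near_midpoint`, `exists_pair`), so such a pair needs just one forced edge.
The chain grows beyond a hull wall `p q` by triangles `p q z` and `z q y`, with `y z` in the
matching; the walls `p q`, `p z`, `z q`, `z y` each hide a pair (`HasOpenConfig.succ`). This costs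
10 vertices, 7 forced edges and one matching edge, so 2n - |G| grows by 20 - 7 = 13, the denominator
in the theorem.

A saturated polygon at the start of the chain adjusts n; each of its vertices beyond the first two
brings 2 forced edges and leaves 2n - |G| unchanged. With k + 1 matching edges the closed chain
realises 5k + 5 ≤ 2n - m ≤ 13k + 10. This contains all values for which the ceiling is k + 1, except
2n - m ≤ 4 when k = 0; there a triangulation with one hull edge declared to be the matching is used
(`hasConfig_triangulation`). Part (b) is part (a) at m = ⌊dn⌋. -/

open Topology

/-! ### Orientation and intersection of segments. -/

/-- Twice the signed area of the triangle `a b c`. -/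
def orient (a b c : ℝ × ℝ) : ℝ :=
  (b.1 - a.1) * (c.2 - a.2) - (b.2 - a.2) * (c.1 - a.1)

theorem orient_rotate (a b c : ℝ × ℝ) : orient b c a = orient a b c := by
  unfold orient; ring

theorem orient_swap_left (a b c : ℝ × ℝ) : orient b a c = -orient a b c := by
  unfold orient; ring

theorem orient_swap_right (a b c : ℝ × ℝ) : orient a c b = -orient a b c := by
  unfold orient; ring

@[simp] theorem orient_self_left (a b : ℝ × ℝ) : orient a b a = 0 := by
  unfold orient; ring

@[simp] theorem orient_self_right (a b : ℝ × ℝ) : orient a b b = 0 := by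
  unfold orient; ring

theorem orient_combo (a b c d : ℝ × ℝ) {s t : ℝ} (h : s + t = 1) :
    orient a b (s • c + t • d) = s * orient a b c + t * orient a b d := by
  obtain rfl : s = 1 - t := by linarith
  simp only [orient, Prod.fst_add, Prod.snd_add, Prod.smul_fst, Prod.smul_snd, smul_eq_mul]
  ring

theorem orient_midpoint (a b c d : ℝ × ℝ) :
    orient a b (midpoint ℝ c d) = (orient a b c + orient a b d) / 2 := by
  rw [midpoint_eq_smul_add, smul_add, orient_combo _ _ _ _ (by norm_num), invOf_eq_inv]
  ring

theorem continuous_orient {X : Type*} [TopologicalSpace X] {f g h : X → ℝ × ℝ}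
    (hf : Continuous f) (hg : Continuous g) (hh : Continuous h) :
    Continuous fun x => orient (f x) (g x) (h x) := by
  unfold orient; fun_prop

theorem not_collinear_of_orient_ne_zero {a b c : ℝ × ℝ} (h : orient a b c ≠ 0) :
    ¬ Collinear ℝ {a, b, c} := by
  intro hc
  obtain ⟨v, hv⟩ := (collinear_iff_of_mem (k := ℝ) (p₀ := a) (by simp)).1 hc
  obtain ⟨r, rfl⟩ := hv b (by simp)
  obtain ⟨t, rfl⟩ := hv c (by simp)
  apply h
  simp only [orient, vadd_eq_add, Prod.fst_add, Prod.snd_add, Prod.smul_fst, Prod.smul_snd,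
    smul_eq_mul]
  ring

/-- Two segments that are separated by an affine function are disjoint. -/
theorem disjoint_segment_of_separated {f : ℝ × ℝ → ℝ}
    (hf : ∀ (c d : ℝ × ℝ) (s t : ℝ), s + t = 1 → f (s • c + t • d) = s * f c + t * f d)
    {a b c d : ℝ × ℝ} (ha : f a ≤ 0) (hb : f b ≤ 0) (hc : 0 < f c) (hd : 0 < f d) :
    Disjoint (segment ℝ a b) (segment ℝ c d) := by
  rw [Set.disjoint_left]
  rintro x ⟨s, t, hs, ht, hst, rfl⟩ ⟨s', t', hs', ht', hst', hx⟩
  have h1 := hf a b s t hst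
  rw [← hx, hf c d s' t' hst'] at h1
  have h2 : 0 < s' * f c + t' * f d := by
    rcases hs'.eq_or_lt with rfl | hs'
    · obtain rfl : t' = 1 := by linarith
      simpa using hd
    · have := mul_pos hs' hc
      have := mul_nonneg ht' hd.le
      linarith
  have := mul_nonpos_of_nonneg_of_nonpos hs ha
  have := mul_nonpos_of_nonneg_of_nonpos ht hb
  linarith

theorem disjoint_segment_of_orient_pos {p q a b c d : ℝ × ℝ} (ha : orient p q a ≤ 0)
    (hb : orient p q b ≤ 0) (hc : 0 < orient p q c) (hd : 0 < orient p q d) :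
    Disjoint (segment ℝ a b) (segment ℝ c d) :=
  disjoint_segment_of_separated (f := orient p q) (fun _ _ _ _ h => orient_combo _ _ _ _ h)
    ha hb hc hd

theorem disjoint_segment_of_orient_neg {p q a b c d : ℝ × ℝ} (ha : orient p q a < 0)
    (hb : orient p q b < 0) (hc : 0 ≤ orient p q c) (hd : 0 ≤ orient p q d) :
    Disjoint (segment ℝ a b) (segment ℝ c d) :=
  (disjoint_segment_of_separated (f := fun x => -orient p q x)
    (fun _ _ _ _ h => by simp only [orient_combo _ _ _ _ h]; ring)
    (by linarith) (by linarith) (by linarith) (by linarith) : Disjoint (segment ℝ c d) _).symm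

/-- Two segments with a common end meet only there, unless they are collinear. -/
theorem segment_inter_segment_subset {a b c : ℝ × ℝ} (h : orient a b c ≠ 0) :
    segment ℝ a b ∩ segment ℝ a c ⊆ {a} := by
  rintro x ⟨⟨s, t, hs, ht, hst, rfl⟩, ⟨s', t', hs', ht', hst', hx⟩⟩
  have h1 : t' = 0 := by
    have := congrArg (orient a b) hx
    rw [orient_combo _ _ _ _ hst, orient_combo _ _ _ _ hst'] at this
    simpa [h] using this
  subst h1
  obtain rfl : s' = 1 := by linarith
  simpa using hx.symm

/-- If `v` and `w` lie on different sides of `p q`, and `p` and `q` on different sides of `v w`,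
then the two segments meet. -/
theorem segment_inter_segment_nonempty {p q v w : ℝ × ℝ} (hv : orient p q v < 0)
    (hw : 0 < orient p q w) (hp : 0 < orient p v w) (hq : 0 < orient v q w) :
    (segment ℝ v w ∩ segment ℝ p q).Nonempty := by
  -- `D` is twice the area of the quadrilateral `p v q w`, computed by cutting along `p q`; `hD1`
  -- cuts along `v w`. Ratios of the triangle areas to `D` are the coordinates of the crossing point
  -- on both segments.
  set D := orient p q w - orient p q v with hD
  have hD0 : 0 < D := by linarith
  have hD1 : D = orient p v w + orient v q w := by rw [hD]; unfold orient; ring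
  refine ⟨(orient p q w / D) • v + (-orient p q v / D) • w, ⟨_, _, ?_, ?_, ?_, rfl⟩,
    ⟨orient v q w / D, orient p v w / D, ?_, ?_, ?_, ?_⟩⟩
  · positivity
  · exact div_nonneg (by linarith) hD0.le
  · field_simp; linarith
  · positivity
  · positivity
  · field_simp; linarith
  · have hD2 := hD0.ne'
    ext
    · simp only [Prod.fst_add, Prod.smul_fst, smul_eq_mul]
      field_simp
      unfold orient; ring
    · simp only [Prod.snd_add, Prod.smul_snd, smul_eq_mul]
      field_simp
      unfold orient; ring

/-! ### Choosing points in general position. -/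

theorem dense_orient_ne_zero {a b : ℝ × ℝ} (h : a ≠ b) : Dense {v | orient a b v ≠ 0} := by
  intro v
  by_cases hv : orient a b v = 0
  · set n : ℝ × ℝ := (-(b.2 - a.2), b.1 - a.1) with hn
    have hc : Tendsto (fun t : ℝ => v + t • n) (𝓝[≠] 0) (𝓝 v) := by
      have : Continuous fun t : ℝ => v + t • n := by fun_prop
      simpa using (this.tendsto 0).mono_left nhdsWithin_le_nhds
    refine mem_closure_of_tendsto hc ?_
    filter_upwards [self_mem_nhdsWithin] with t ht
    have h1 : orient a b (v + t • n) = t * ((b.1 - a.1) ^ 2 + (b.2 - a.2) ^ 2) := by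
      rw [← sub_zero (orient _ _ _), ← hv, hn]
      simp only [orient, Prod.fst_add, Prod.snd_add, Prod.smul_fst, Prod.smul_snd, smul_eq_mul]
      ring
    have h2 : (b.1 - a.1) ^ 2 + (b.2 - a.2) ^ 2 ≠ 0 := by
      intro h0
      apply h
      have h3 : b.1 - a.1 = 0 := by nlinarith [sq_nonneg (b.1 - a.1), sq_nonneg (b.2 - a.2)]
      have h4 : b.2 - a.2 = 0 := by nlinarith [sq_nonneg (b.1 - a.1), sq_nonneg (b.2 - a.2)]
      ext <;> linarith
    simp only [h1]
    exact mul_ne_zero ht h2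
  · exact subset_closure hv

/-- Near every point of the closure of an open set there are points of that set that lie on no line
spanned by two points of a given finite set. -/
theorem exists_generic (S : Finset (ℝ × ℝ)) {U : Set (ℝ × ℝ)} (hU : IsOpen U) {v₀ : ℝ × ℝ}
    (hv₀ : v₀ ∈ closure U) {Q : ℝ × ℝ → Prop} (hQ : ∀ᶠ v in 𝓝 v₀, Q v) :
    ∃ v ∈ U, Q v ∧ ∀ a ∈ S, ∀ b ∈ S, a ≠ b → orient a b v ≠ 0 := by
  have hd : Dense (⋂ e ∈ S.offDiag, {v : ℝ × ℝ | orient e.1 e.2 v ≠ 0}) := by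
    refine dense_biInter_of_isOpen (S := (S.offDiag : Set ((ℝ × ℝ) × (ℝ × ℝ)))) ?_
      (S.offDiag.countable_toSet) ?_
    · intro e _
      exact isOpen_ne_fun (continuous_orient continuous_const continuous_const continuous_id)
        continuous_const
    · intro e he
      exact dense_orient_ne_zero (Finset.mem_offDiag.1 he).2.2
  obtain ⟨O, hOQ, hO, hvO⟩ := eventually_nhds_iff.1 hQ
  obtain ⟨x, hxO, hxU⟩ := mem_closure_iff.1 hv₀ O hO hvO
  obtain ⟨v, ⟨hvO, hvU⟩, hv⟩ := hd.inter_open_nonempty _ (hO.inter hU) ⟨x, hxO, hxU⟩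
  refine ⟨v, hvU, hOQ v hvO, fun a ha b hb hab => ?_⟩
  simp only [Set.mem_iInter] at hv
  exact hv (a, b) (Finset.mem_offDiag.2 ⟨ha, hb, hab⟩)

/-- There is a point close to the midpoint of `p q`, to the right of `p q`, in general position,
from which the points to the left of `p q` are seen through the segment `p q`. -/
theorem exists_near_midpoint (S : Finset (ℝ × ℝ)) {p q : ℝ × ℝ} (hpq : p ≠ q)
    {Q : ℝ × ℝ → Prop} (hQ : ∀ᶠ v in 𝓝 (midpoint ℝ p q), Q v) :
    ∃ v, Q v ∧ orient p q v < 0 ∧ (∀ a ∈ S, ∀ b ∈ S, a ≠ b → orient a b v ≠ 0) ∧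
      ∀ w ∈ S, 0 < orient p q w → 0 < orient p v w ∧ 0 < orient v q w := by
  have hcl : midpoint ℝ p q ∈ closure {v | orient p q v < 0} := by
    set n : ℝ × ℝ := (q.2 - p.2, -(q.1 - p.1)) with hn
    have hc : Tendsto (fun t : ℝ => midpoint ℝ p q + t • n) (𝓝[>] 0) (𝓝 (midpoint ℝ p q)) := by
      have : Continuous fun t : ℝ => midpoint ℝ p q + t • n := by fun_prop
      simpa using (this.tendsto 0).mono_left nhdsWithin_le_nhds
    refine mem_closure_of_tendsto hc ?_
    filter_upwards [self_mem_nhdsWithin] with t ht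
    have h0 : orient p q (midpoint ℝ p q) = 0 := by simp [orient_midpoint]
    have h1 : orient p q (midpoint ℝ p q + t • n) =
        -(t * ((q.1 - p.1) ^ 2 + (q.2 - p.2) ^ 2)) := by
      rw [← sub_zero (orient _ _ _), ← h0, hn]
      simp only [orient, Prod.fst_add, Prod.snd_add, Prod.smul_fst, Prod.smul_snd, smul_eq_mul]
      ring
    have h2 : 0 < (q.1 - p.1) ^ 2 + (q.2 - p.2) ^ 2 := by
      by_contra hcon
      apply hpq
      have h3 : q.1 - p.1 = 0 := by nlinarith [sq_nonneg (q.1 - p.1), sq_nonneg (q.2 - p.2)]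
      have h4 : q.2 - p.2 = 0 := by nlinarith [sq_nonneg (q.1 - p.1), sq_nonneg (q.2 - p.2)]
      ext <;> linarith
    simp only [h1]
    exact neg_neg_of_pos (mul_pos ht h2)
  have hS : ∀ᶠ v in 𝓝 (midpoint ℝ p q),
      ∀ w ∈ S, 0 < orient p q w → 0 < orient p v w ∧ 0 < orient v q w := by
    rw [eventually_all_finset]
    intro w _
    by_cases hw : 0 < orient p q w
    · have h1 : 0 < orient p (midpoint ℝ p q) w := by
        rw [← orient_rotate, ← orient_rotate, orient_midpoint, ← orient_rotate w p q]
        simpa [orient_self_right] using hw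
      have h2 : 0 < orient (midpoint ℝ p q) q w := by
        rw [← orient_rotate, orient_midpoint, orient_rotate p q w]
        simpa [orient_self_left] using hw
      have c1 : Continuous fun v => orient p v w :=
        continuous_orient continuous_const continuous_id continuous_const
      have c2 : Continuous fun v => orient v q w :=
        continuous_orient continuous_id continuous_const continuous_const
      filter_upwards [c1.continuousAt.eventually (lt_mem_nhds h1),
        c2.continuousAt.eventually (lt_mem_nhds h2)] with v hv1 hv2 _
      exact ⟨hv1, hv2⟩
    · exact Eventually.of_forall fun v h => absurd h hw
  obtain ⟨v, hv, ⟨hvQ, hvS⟩, hg⟩ := exists_generic S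
    (isOpen_lt (continuous_orient continuous_const continuous_const continuous_id)
      continuous_const) hcl (hQ.and hS)
  exact ⟨v, hvQ, hv, hg, hvS⟩

/-- There is a point close to the corner `y` of the path `x y z`, on the outer side of both edges,
in general position. -/
theorem exists_near_corner (S : Finset (ℝ × ℝ)) {x y z : ℝ × ℝ} (h : 0 < orient x y z)
    {Q : ℝ × ℝ → Prop} (hQ : ∀ᶠ v in 𝓝 y, Q v) :
    ∃ v, Q v ∧ orient x y v < 0 ∧ orient y z v < 0 ∧
      ∀ a ∈ S, ∀ b ∈ S, a ≠ b → orient a b v ≠ 0 := by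
  have hcl : y ∈ closure ({v | orient x y v < 0} ∩ {v | orient y z v < 0}) := by
    -- Moving from `y` by `t • n` changes both orientations by the same amount, `-(t * orient x y
    -- z)`.
    set n : ℝ × ℝ := (y - x) + (y - z) with hn
    have hc : Tendsto (fun t : ℝ => y + t • n) (𝓝[>] 0) (𝓝 y) := by
      have : Continuous fun t : ℝ => y + t • n := by fun_prop
      simpa using (this.tendsto 0).mono_left nhdsWithin_le_nhds
    refine mem_closure_of_tendsto hc ?_
    filter_upwards [self_mem_nhdsWithin] with t ht
    have h1 : orient x y (y + t • n) = -(t * orient x y z) := by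
      simp only [hn, orient, Prod.fst_add, Prod.snd_add, Prod.smul_fst, Prod.smul_snd,
        Prod.fst_sub, Prod.snd_sub, smul_eq_mul]
      ring
    have h2 : orient y z (y + t • n) = -(t * orient x y z) := by
      simp only [hn, orient, Prod.fst_add, Prod.snd_add, Prod.smul_fst, Prod.smul_snd,
        Prod.fst_sub, Prod.snd_sub, smul_eq_mul]
      ring
    simp only [Set.mem_inter_iff, Set.mem_ofPred_eq, h1, h2]
    have := mul_pos ht h
    constructor <;> linarith
  have hopen (a b : ℝ × ℝ) : IsOpen {v | orient a b v < 0} :=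
    isOpen_lt (continuous_orient continuous_const continuous_const continuous_id)
      continuous_const
  obtain ⟨v, ⟨hv1, hv2⟩, hvQ, hg⟩ := exists_generic S ((hopen x y).inter (hopen y z)) hcl hQ
  exact ⟨v, hvQ, hv1, hv2, hg⟩

/-! ### Configurations and their elementary modifications. -/

/-- The segment `u v` meets an edge of `E` that ends neither in `u` nor in `v`. -/
def Blocked (E : Finset (Sym2 (ℝ × ℝ))) (u v : ℝ × ℝ) : Prop :=
  ∃ c d, s(c, d) ∈ E ∧ u ≠ c ∧ u ≠ d ∧ v ≠ c ∧ v ≠ d ∧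
    (segment ℝ u v ∩ segment ℝ c d).Nonempty

theorem Blocked.mono {E E' : Finset (Sym2 (ℝ × ℝ))} {u v : ℝ × ℝ} (h : Blocked E u v)
    (hE : E ⊆ E') : Blocked E' u v := by
  obtain ⟨c, d, hcd, h⟩ := h
  exact ⟨c, d, hE hcd, h⟩

theorem Blocked.symm {E : Finset (Sym2 (ℝ × ℝ))} {u v : ℝ × ℝ} (h : Blocked E u v) :
    Blocked E v u := by
  obtain ⟨c, d, hcd, h1, h2, h3, h4, h5⟩ := h
  exact ⟨c, d, hcd, h3, h4, h1, h2, by rwa [segment_symm]⟩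

/-- A finite set `S` of points in general position with a noncrossing graph `T`, a subgraph `G`
and a matching `M` in `T` on vertices of `W`, such that any two points outside `W` are adjacent
in `G` or separated by an edge of `G` or `M`. -/
structure Config (S W : Finset (ℝ × ℝ)) (G M T : Finset (Sym2 (ℝ × ℝ))) : Prop where
  orient_ne : ∀ a ∈ S, ∀ b ∈ S, ∀ c ∈ S, a ≠ b → a ≠ c → b ≠ c → orient a b c ≠ 0
  mem : ∀ a b, s(a, b) ∈ T → a ∈ S
  ne : ∀ a b, s(a, b) ∈ T → a ≠ b
  W_subset : W ⊆ S
  G_subset : G ⊆ T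
  M_subset : M ⊆ T
  disjoint : Disjoint G M
  noncrossing : ∀ a b c d, s(a, b) ∈ T → s(c, d) ∈ T → a ≠ c → a ≠ d → b ≠ c → b ≠ d →
    Disjoint (segment ℝ a b) (segment ℝ c d)
  matching : ∀ a b c, s(a, b) ∈ M → s(a, c) ∈ M → b = c
  mem_W : ∀ a b, s(a, b) ∈ M → a ∈ W
  saturated : ∀ u ∈ S, ∀ v ∈ S, u ∉ W → v ∉ W → u ≠ v → s(u, v) ∈ G ∨ Blocked (G ∪ M) u v

namespace Config

variable {S W : Finset (ℝ × ℝ)} {G M T : Finset (Sym2 (ℝ × ℝ))}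

theorem mem_right (h : Config S W G M T) {a b : ℝ × ℝ} (hab : s(a, b) ∈ T) : b ∈ S :=
  h.mem b a (by rwa [Sym2.eq_swap])

theorem notMem_edge (h : Config S W G M T) {v : ℝ × ℝ} (hv : v ∉ S) (x : ℝ × ℝ) :
    s(v, x) ∉ T := fun h' => hv (h.mem v x h')

/-- A new point enters as exempt, so saturation asks nothing of it. It must later be covered by `M`
or freed by `release`. -/
theorem addPoint (h : Config S W G M T) {v : ℝ × ℝ} (hv : v ∉ S)
    (hg : ∀ a ∈ S, ∀ b ∈ S, a ≠ b → orient a b v ≠ 0) :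
    Config (insert v S) (insert v W) G M T where
  orient_ne := by
    intro a ha b hb c hc hab hac hbc
    rw [Finset.mem_insert] at ha hb hc
    rcases ha with rfl | ha
    · rw [← orient_rotate]
      exact hg b (hb.resolve_left hab.symm) c (hc.resolve_left hac.symm) hbc
    rcases hb with rfl | hb
    · rw [← orient_rotate, ← orient_rotate]
      exact hg c (hc.resolve_left hbc.symm) a ha hac.symm
    rcases hc with rfl | hc
    · exact hg a ha b hb hab
    · exact h.orient_ne a ha b hb c hc hab hac hbc
  mem a b hab := Finset.mem_insert_of_mem (h.mem a b hab)
  ne := h.ne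
  W_subset := Finset.insert_subset_insert _ h.W_subset
  G_subset := h.G_subset
  M_subset := h.M_subset
  disjoint := h.disjoint
  noncrossing := h.noncrossing
  matching := h.matching
  mem_W a b hab := Finset.mem_insert_of_mem (h.mem_W a b hab)
  saturated := by
    intro u hu w hw huW hwW
    rw [Finset.mem_insert, not_or] at huW hwW
    exact h.saturated u ((Finset.mem_insert.1 hu).resolve_left huW.1) w
      ((Finset.mem_insert.1 hw).resolve_left hwW.1) huW.2 hwW.2

/-- Only edges without a common end have to be checked: general position takes care of the others.
-/
theorem addEdge (h : Config S W G M T) {a b : ℝ × ℝ} (ha : a ∈ S) (hb : b ∈ S) (hab : a ≠ b)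
    (hT : ∀ c d, s(c, d) ∈ T → a ≠ c → a ≠ d → b ≠ c → b ≠ d →
      Disjoint (segment ℝ a b) (segment ℝ c d)) :
    Config S W G M (insert s(a, b) T) where
  orient_ne := h.orient_ne
  mem := by
    intro c d hcd
    rcases Finset.mem_insert.1 hcd with hcd | hcd
    · rcases Sym2.eq_iff.1 hcd with ⟨rfl, rfl⟩ | ⟨rfl, rfl⟩ <;> assumption
    · exact h.mem c d hcd
  ne := by
    intro c d hcd
    rcases Finset.mem_insert.1 hcd with hcd | hcd
    · rcases Sym2.eq_iff.1 hcd with ⟨rfl, rfl⟩ | ⟨rfl, rfl⟩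
      exacts [hab, hab.symm]
    · exact h.ne c d hcd
  W_subset := h.W_subset
  G_subset := h.G_subset.trans (Finset.subset_insert _ _)
  M_subset := h.M_subset.trans (Finset.subset_insert _ _)
  disjoint := h.disjoint
  noncrossing := by
    intro x y c d hxy hcd h1 h2 h3 h4
    rw [Finset.mem_insert] at hxy hcd
    rcases hxy with hxy | hxy <;> rcases hcd with hcd | hcd
    · rw [← hxy, Sym2.eq_iff] at hcd
      rcases hcd with ⟨rfl, rfl⟩ | ⟨rfl, rfl⟩
      exacts [absurd rfl h1, absurd rfl h2]
    · rcases Sym2.eq_iff.1 hxy with ⟨rfl, rfl⟩ | ⟨rfl, rfl⟩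
      · exact hT c d hcd h1 h2 h3 h4
      · rw [segment_symm]
        exact hT c d hcd h3 h4 h1 h2
    · rcases Sym2.eq_iff.1 hcd with ⟨rfl, rfl⟩ | ⟨rfl, rfl⟩
      · exact (hT x y hxy h1.symm h3.symm h2.symm h4.symm).symm
      · rw [segment_symm ℝ c d]
        exact (hT x y hxy h2.symm h4.symm h1.symm h3.symm).symm
    · exact h.noncrossing x y c d hxy hcd h1 h2 h3 h4
  matching := h.matching
  mem_W := h.mem_W
  saturated := h.saturated

theorem moveToG (h : Config S W G M T) {e : Sym2 (ℝ × ℝ)} (he : e ∈ T) (heM : e ∉ M) :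
    Config S W (insert e G) M T where
  orient_ne := h.orient_ne
  mem := h.mem
  ne := h.ne
  W_subset := h.W_subset
  G_subset := Finset.insert_subset he h.G_subset
  M_subset := h.M_subset
  disjoint := Finset.disjoint_insert_left.2 ⟨heM, h.disjoint⟩
  noncrossing := h.noncrossing
  matching := h.matching
  mem_W := h.mem_W
  saturated u hu v hv huW hvW huv := (h.saturated u hu v hv huW hvW huv).imp
    (fun h => Finset.mem_insert_of_mem h)
    (fun h => h.mono (Finset.union_subset_union_left (Finset.subset_insert _ _)))

theorem moveToM (h : Config S W G M T) {a b : ℝ × ℝ} (he : s(a, b) ∈ T) (heG : s(a, b) ∉ G)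
    (ha : a ∈ W) (hb : b ∈ W) (haM : ∀ x, s(a, x) ∉ M) (hbM : ∀ x, s(b, x) ∉ M) :
    Config S W G (insert s(a, b) M) T where
  orient_ne := h.orient_ne
  mem := h.mem
  ne := h.ne
  W_subset := h.W_subset
  G_subset := h.G_subset
  M_subset := Finset.insert_subset he h.M_subset
  disjoint := Finset.disjoint_insert_right.2 ⟨heG, h.disjoint⟩
  noncrossing := h.noncrossing
  matching := by
    intro x y z hy hz
    have hab := h.ne a b he
    rw [Finset.mem_insert] at hy hz
    rcases hy with hy | hy <;> rcases hz with hz | hz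
    · rcases Sym2.eq_iff.1 hy with ⟨rfl, rfl⟩ | ⟨rfl, rfl⟩ <;>
        rcases Sym2.eq_iff.1 hz with ⟨h1, h2⟩ | ⟨h1, h2⟩
      · exact h2.symm
      · exact absurd h1 hab
      · exact absurd h1.symm hab
      · exact h2.symm
    · rcases Sym2.eq_iff.1 hy with ⟨rfl, rfl⟩ | ⟨rfl, rfl⟩
      exacts [absurd hz (haM _), absurd hz (hbM _)]
    · rcases Sym2.eq_iff.1 hz with ⟨rfl, rfl⟩ | ⟨rfl, rfl⟩
      exacts [absurd hy (haM _), absurd hy (hbM _)]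
    · exact h.matching x y z hy hz
  mem_W := by
    intro x y hxy
    rcases Finset.mem_insert.1 hxy with hxy | hxy
    · rcases Sym2.eq_iff.1 hxy with ⟨rfl, rfl⟩ | ⟨rfl, rfl⟩ <;> assumption
    · exact h.mem_W x y hxy
  saturated u hu v hv huW hvW huv := (h.saturated u hu v hv huW hvW huv).imp id
    (fun h => h.mono (Finset.union_subset_union_right (Finset.subset_insert _ _)))

theorem release (h : Config S W G M T) {v : ℝ × ℝ} {W' : Finset (ℝ × ℝ)} (hW : W = insert v W')
    (hv : v ∉ W') (hvM : ∀ x, s(v, x) ∉ M)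
    (hs : ∀ w ∈ S, w ∉ W' → w ≠ v → s(v, w) ∈ G ∨ Blocked (G ∪ M) v w) :
    Config S W' G M T where
  orient_ne := h.orient_ne
  mem := h.mem
  ne := h.ne
  W_subset := (Finset.subset_insert v W').trans (hW ▸ h.W_subset)
  G_subset := h.G_subset
  M_subset := h.M_subset
  disjoint := h.disjoint
  noncrossing := h.noncrossing
  matching := h.matching
  mem_W := by
    intro a b hab
    have := h.mem_W a b hab
    rw [hW, Finset.mem_insert] at this
    exact this.resolve_left (by rintro rfl; exact hvM b hab)
  saturated := by
    intro x hx y hy hxW hyW hxy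
    by_cases hxv : x = v
    · subst hxv
      exact hs y hy hyW hxy.symm
    by_cases hyv : y = v
    · subst hyv
      rw [Sym2.eq_swap]
      exact (hs x hx hxW hxy).imp id Blocked.symm
    · exact h.saturated x hx y hy (by simp [hW, hxv, hxW]) (by simp [hW, hyv, hyW]) hxy

end Config

/-! ### Hull edges and the insertion of vertices. -/

/-- All points of `S` other than `p` and `q` lie to the left of `p q`. -/
structure IsHullEdge (S : Finset (ℝ × ℝ)) (p q : ℝ × ℝ) : Prop where
  left_mem : p ∈ S
  right_mem : q ∈ S
  ne : p ≠ q
  orient_pos : ∀ w ∈ S, w ≠ p → w ≠ q → 0 < orient p q w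

theorem IsHullEdge.orient_nonneg {S : Finset (ℝ × ℝ)} {p q : ℝ × ℝ} (h : IsHullEdge S p q)
    {w : ℝ × ℝ} (hw : w ∈ S) : 0 ≤ orient p q w := by
  by_cases h1 : w = p
  · simp [h1]
  by_cases h2 : w = q
  · simp [h2]
  exact (h.orient_pos w hw h1 h2).le

/-- A new point is not in the set if it is on no line spanned by the set. -/
theorem notMem_of_orient_ne {S : Finset (ℝ × ℝ)} {p q v : ℝ × ℝ} (hp : p ∈ S) (hq : q ∈ S)
    (hpq : p ≠ q) (hg : ∀ a ∈ S, ∀ b ∈ S, a ≠ b → orient a b v ≠ 0) : v ∉ S := by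
  intro hv
  by_cases h : v = p
  · exact hg v hv q hq (h ▸ hpq) (by simp)
  · exact hg v hv p hp h (by simp)

namespace Config

variable {S W : Finset (ℝ × ℝ)} {G M T : Finset (Sym2 (ℝ × ℝ))}

/-- A new vertex beyond a hull edge, joined to the ends of that edge. -/
theorem exists_outer (h : Config S W G M T) {p q : ℝ × ℝ} (hpq : IsHullEdge S p q) :
    ∃ v, v ∉ S ∧ Config (insert v S) (insert v W) G M (insert s(v, q) (insert s(v, p) T)) ∧
      (insert s(v, q) (insert s(v, p) T)).card = T.card + 2 ∧
      IsHullEdge (insert v S) p v ∧ IsHullEdge (insert v S) v q ∧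
      ∀ w ∈ S, w ≠ p → w ≠ q → (segment ℝ v w ∩ segment ℝ p q).Nonempty := by
  obtain ⟨v, -, hv, hg, hS⟩ := exists_near_midpoint S hpq.ne (Q := fun _ => True)
    (Eventually.of_forall fun _ => trivial)
  have hvS := notMem_of_orient_ne hpq.left_mem hpq.right_mem hpq.ne hg
  have hvp : v ≠ p := fun e => hvS (e ▸ hpq.left_mem)
  have hvq : v ≠ q := fun e => hvS (e ▸ hpq.right_mem)
  have h1 : IsHullEdge (insert v S) p v := by
    refine ⟨Finset.mem_insert_of_mem hpq.left_mem, Finset.mem_insert_self _ _, hvp.symm, ?_⟩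
    intro w hw hwp hwv
    have hwS := (Finset.mem_insert.1 hw).resolve_left hwv
    by_cases hwq : w = q
    · subst hwq
      rw [orient_swap_right]; linarith
    · exact (hS w hwS (hpq.orient_pos w hwS hwp hwq)).1
  have h2 : IsHullEdge (insert v S) v q := by
    refine ⟨Finset.mem_insert_self _ _, Finset.mem_insert_of_mem hpq.right_mem, hvq, ?_⟩
    intro w hw hwv hwq
    have hwS := (Finset.mem_insert.1 hw).resolve_left hwv
    by_cases hwp : w = p
    · subst hwp
      rw [orient_rotate, orient_swap_right]
      linarith
    · exact (hS w hwS (hpq.orient_pos w hwS hwp hwq)).2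
  refine ⟨v, hvS, ?_, ?_, h1, h2, ?_⟩
  · refine ((h.addPoint hvS hg).addEdge h1.right_mem h1.left_mem hvp ?_).addEdge
      h2.left_mem h2.right_mem hvq ?_
    · intro c d hcd h3 h4 h5 h6
      exact disjoint_segment_of_orient_pos (p := p) (q := v) (by simp) (by simp)
        (h1.orient_pos c (Finset.mem_insert_of_mem (h.mem c d hcd)) h5.symm h3.symm)
        (h1.orient_pos d (Finset.mem_insert_of_mem (h.mem_right hcd)) h6.symm h4.symm)
    · intro c d hcd h3 h4 h5 h6
      have hcd : s(c, d) ∈ T := by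
        refine (Finset.mem_insert.1 hcd).resolve_left fun e => ?_
        rcases Sym2.eq_iff.1 e with ⟨rfl, rfl⟩ | ⟨rfl, rfl⟩
        exacts [h3 rfl, h4 rfl]
      exact disjoint_segment_of_orient_pos (p := v) (q := q) (by simp) (by simp)
        (h2.orient_pos c (Finset.mem_insert_of_mem (h.mem c d hcd)) h3.symm h5.symm)
        (h2.orient_pos d (Finset.mem_insert_of_mem (h.mem_right hcd)) h4.symm h6.symm)
  · rw [Finset.card_insert_of_notMem, Finset.card_insert_of_notMem (h.notMem_edge hvS p)]
    rw [Finset.mem_insert, not_or]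
    refine ⟨fun e => ?_, h.notMem_edge hvS q⟩
    exact hpq.ne (Sym2.congr_right.1 e).symm
  · intro w hw hwp hwq
    have h3 := hpq.orient_pos w hw hwp hwq
    exact segment_inter_segment_nonempty hv h3 (hS w hw h3).1 (hS w hw h3).2

/-- Two new adjacent vertices close to the midpoint of the edge `p q`, on its right side. -/
theorem exists_pair (h : Config S W G M T) {p q : ℝ × ℝ} (hp : p ∈ W) (hq : q ∈ W)
    (hpq : s(p, q) ∈ G ∪ M) (hleft : ∀ w ∈ S, w ∉ W → 0 < orient p q w)
    (hwall : ∀ c d, s(c, d) ∈ T → (0 ≤ orient p q c ∧ 0 ≤ orient p q d) ∨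
      0 ≤ orient c d p * orient c d q)
    {Q : ℝ × ℝ → Prop} (hQ : ∀ᶠ v in 𝓝 (midpoint ℝ p q), Q v) :
    ∃ u u', u ∉ S ∧ u' ∉ S ∧ u ≠ u' ∧ Q u ∧ Q u' ∧
      ∃ G' T', Config (insert u' (insert u S)) W G' M T' ∧ G ⊆ G' ∧
        G'.card = G.card + 1 ∧ T'.card = T.card + 3 := by
  have hpS := h.W_subset hp
  have hqS := h.W_subset hq
  have hpqT : s(p, q) ∈ T := Finset.union_subset h.G_subset h.M_subset hpq
  have hne : p ≠ q := h.ne p q hpqT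
  have hside : ∀ c d, s(c, d) ∈ T → (0 ≤ orient p q c ∧ 0 ≤ orient p q d) ∨
      (0 ≤ orient c d p ∧ 0 ≤ orient c d q ∧ 0 < orient c d (midpoint ℝ p q)) ∨
      (0 ≤ orient d c p ∧ 0 ≤ orient d c q ∧ 0 < orient d c (midpoint ℝ p q)) := by
    intro c d hcd
    have hc := h.mem c d hcd
    have hd := h.mem_right hcd
    rcases hwall c d hcd with h1 | h1
    · exact Or.inl h1
    -- A nonnegative product and a zero sum make both terms vanish, so by general position `c d` is
    -- `p q` itself. Otherwise the midpoint lies strictly on the common side of `p` and `q`.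
    by_cases h0 : orient c d p + orient c d q = 0
    · have h2 : orient c d p = 0 := by nlinarith
      have h3 : orient c d q = 0 := by linarith
      have h4 : c = p ∨ d = p := by
        by_contra! hcon
        exact h.orient_ne c hc d hd p hpS (h.ne c d hcd) hcon.1 hcon.2 h2
      have h5 : c = q ∨ d = q := by
        by_contra! hcon
        exact h.orient_ne c hc d hd q hqS (h.ne c d hcd) hcon.1 hcon.2 h3
      left
      rcases h4 with rfl | rfl <;> rcases h5 with rfl | rfl <;> simp_all
    right
    rw [orient_swap_left c d, orient_swap_left c d, orient_swap_left c d, orient_midpoint]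
    rcases mul_nonneg_iff.1 h1 with ⟨h2, h3⟩ | ⟨h2, h3⟩
    · have := lt_of_le_of_ne (add_nonneg h2 h3) (Ne.symm h0)
      exact Or.inl ⟨h2, h3, by linarith⟩
    · have := lt_of_le_of_ne (add_nonpos h2 h3) h0
      exact Or.inr ⟨by linarith, by linarith, by linarith⟩
  have hnear : ∀ᶠ v in 𝓝 (midpoint ℝ p q), ∀ c ∈ S, ∀ d ∈ S,
      0 < orient c d (midpoint ℝ p q) → 0 < orient c d v := by
    rw [eventually_all_finset]
    intro c _
    rw [eventually_all_finset]
    intro d _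
    by_cases h0 : 0 < orient c d (midpoint ℝ p q)
    · have hcont : Continuous fun v => orient c d v :=
        continuous_orient continuous_const continuous_const continuous_id
      filter_upwards [hcont.continuousAt.eventually (lt_mem_nhds h0)] with v hv _ using hv
    · exact Eventually.of_forall fun v h => absurd h h0
  obtain ⟨u, ⟨hQu, hsu⟩, hu, hgu, hlu⟩ := exists_near_midpoint S hne (hQ.and hnear)
  obtain ⟨u', ⟨hQu', hsu'⟩, hu', hgu', hlu'⟩ :=
    exists_near_midpoint (insert u S) hne (hQ.and hnear)
  have huS : u ∉ S := notMem_of_orient_ne hpS hqS hne hgu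
  have huS' : u' ∉ insert u S := notMem_of_orient_ne (Finset.mem_insert_of_mem hpS)
    (Finset.mem_insert_of_mem hqS) hne hgu'
  have huu' : u ≠ u' := fun e => huS' (e ▸ Finset.mem_insert_self _ _)
  have huS'' : u' ∉ S := fun h => huS' (Finset.mem_insert_of_mem h)
  have hup : u ≠ p := fun e => huS (e ▸ hpS)
  have huq : u ≠ q := fun e => huS (e ▸ hqS)
  have hup' : u' ≠ p := fun e => huS'' (e ▸ hpS)
  have huq' : u' ≠ q := fun e => huS'' (e ▸ hqS)
  have hpos : ∀ c ∈ S, 0 ≤ orient p q c → c ≠ p → c ≠ q → 0 < orient p q c :=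
    fun c hc h0 h1 h2 => lt_of_le_of_ne h0
      (h.orient_ne p hpS q hqS c hc hne h1.symm h2.symm).symm
  have hpos' : ∀ c d x, s(c, d) ∈ T → x ∈ S → 0 ≤ orient c d x → x ≠ c → x ≠ d →
      0 < orient c d x :=
    fun c d x hcd hx h0 h1 h2 => lt_of_le_of_ne h0
      (h.orient_ne c (h.mem c d hcd) d (h.mem_right hcd) x hx (h.ne c d hcd) h1.symm h2.symm).symm
  have hpu : ∀ c ∈ S, 0 ≤ orient p q c → c ≠ p → 0 < orient p u c := by
    intro c hc h0 h1
    by_cases h2 : c = q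
    · rw [h2, orient_swap_right]; linarith
    · exact (hlu c hc (hpos c hc h0 h1 h2)).1
  have huq0 : ∀ c ∈ S, 0 ≤ orient p q c → c ≠ q → 0 < orient u q c := by
    intro c hc h0 h1
    by_cases h2 : c = p
    · rw [h2, orient_rotate, orient_swap_right]; linarith
    · exact (hlu c hc (hpos c hc h0 h2 h1)).2
  have hwallDisj : ∀ c d x, s(c, d) ∈ T → x ∈ S → 0 ≤ orient c d x → 0 < orient c d u → x ≠ c →
      x ≠ d → Disjoint (segment ℝ u x) (segment ℝ c d) := fun c d x hcd hx h0 h1 h2 h3 =>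
    (disjoint_segment_of_orient_pos (p := c) (q := d) (by simp) (by simp) h1
      (hpos' c d x hcd hx h0 h2 h3)).symm
  -- An edge to the left of `p q` is separated from the new edge by the line `p u`, any other edge
  -- by its own line.
  have k1 := (h.addPoint huS hgu).addEdge (a := u) (b := p) (by simp) (by simp [hpS]) hup (by
    intro c d hcd _ _ h3 h4
    have hc := h.mem c d hcd
    have hd := h.mem_right hcd
    rcases hside c d hcd with ⟨h5, h6⟩ | ⟨h5, -, h7⟩ | ⟨h5, -, h7⟩
    · exact disjoint_segment_of_orient_pos (p := p) (q := u) (by simp) (by simp)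
        (hpu c hc h5 h3.symm) (hpu d hd h6 h4.symm)
    · exact hwallDisj c d p hcd hpS h5 (hsu c hc d hd h7) h3 h4
    · rw [segment_symm ℝ c d]
      exact hwallDisj d c p (by rwa [Sym2.eq_swap]) hpS h5 (hsu d hd c hc h7) h4 h3)
  have hold : ∀ c d x, s(c, d) ∈ insert s(u, x) T → u ≠ c → u ≠ d → s(c, d) ∈ T := by
    intro c d x hcd h1 h2
    refine (Finset.mem_insert.1 hcd).resolve_left fun e => ?_
    rcases Sym2.eq_iff.1 e with ⟨rfl, -⟩ | ⟨-, rfl⟩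
    exacts [h1 rfl, h2 rfl]
  have k2 := k1.addEdge (a := u) (b := q) (by simp) (by simp [hqS]) huq (by
    intro c d hcd h1 h2 h3 h4
    replace hcd := hold c d p hcd h1 h2
    have hc := h.mem c d hcd
    have hd := h.mem_right hcd
    rcases hside c d hcd with ⟨h5, h6⟩ | ⟨-, h5, h7⟩ | ⟨-, h5, h7⟩
    · exact disjoint_segment_of_orient_pos (p := u) (q := q) (by simp) (by simp)
        (huq0 c hc h5 h3.symm) (huq0 d hd h6 h4.symm)
    · exact hwallDisj c d q hcd hqS h5 (hsu c hc d hd h7) h3 h4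
    · rw [segment_symm ℝ c d]
      exact hwallDisj d c q (by rwa [Sym2.eq_swap]) hqS h5 (hsu d hd c hc h7) h4 h3)
  have k3 := (k2.addPoint huS' hgu').addEdge (a := u) (b := u') (by simp) (by simp) huu' (by
    intro c d hcd h1 h2 _ _
    replace hcd : s(c, d) ∈ T := by
      rw [Finset.mem_insert] at hcd
      rcases hcd with e | hcd
      · rcases Sym2.eq_iff.1 e with ⟨rfl, -⟩ | ⟨-, rfl⟩
        exacts [absurd rfl h1, absurd rfl h2]
      · exact hold c d p hcd h1 h2
    have hc := h.mem c d hcd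
    have hd := h.mem_right hcd
    rcases hside c d hcd with ⟨h5, h6⟩ | ⟨-, -, h7⟩ | ⟨-, -, h7⟩
    · exact disjoint_segment_of_orient_neg hu hu' h5 h6
    · exact (disjoint_segment_of_orient_pos (p := c) (q := d) (by simp) (by simp)
        (hsu c hc d hd h7) (hsu' c hc d hd h7)).symm
    · exact (disjoint_segment_of_orient_pos (p := d) (q := c) (by simp) (by simp)
        (hsu d hd c hc h7) (hsu' d hd c hc h7)).symm)
  have hMu : ∀ v x, v ∉ S → s(v, x) ∉ M := fun v x hv e => h.notMem_edge hv x (h.M_subset e)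
  have k4 := k3.moveToG (e := s(u, u')) (by simp) (hMu u u' huS)
  have hpq' : s(p, q) ∈ insert s(u, u') G ∪ M :=
    Finset.union_subset_union_left (Finset.subset_insert _ _) hpq
  have hblock : ∀ v, v ≠ p → v ≠ q → orient p q v < 0 → ∀ w ∈ S, w ∉ W →
      (0 < orient p q w → 0 < orient p v w ∧ 0 < orient v q w) →
      Blocked (insert s(u, u') G ∪ M) v w := by
    intro v hvp hvq hv w hw hwW hvw
    have h0 := hleft w hw hwW
    exact ⟨p, q, hpq', hvp, hvq, fun e => hwW (e ▸ hp), fun e => hwW (e ▸ hq),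
      segment_inter_segment_nonempty hv h0 (hvw h0).1 (hvw h0).2⟩
  have huW : u ∉ W := fun h' => huS (h.W_subset h')
  have huW' : u' ∉ W := fun h' => huS'' (h.W_subset h')
  -- While `u` is still exempt, `u'` has to be compared with old vertices only.
  have k5 := k4.release rfl (by simp [huW', huu'.symm]) (fun x => hMu u' x huS'') (by
    intro w hw hwW hwu
    rw [Finset.mem_insert, not_or] at hwW
    have hwS : w ∈ S := by simpa [hwu, hwW.1] using hw
    exact Or.inr (hblock u' hup' huq' hu' w hwS hwW.2 (hlu' w (Finset.mem_insert_of_mem hwS))))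
  have k6 := k5.release rfl huW (fun x => hMu u x huS) (by
    intro w hw hwW hwu
    by_cases hwu' : w = u'
    · left; simp [hwu']
    · have hwS : w ∈ S := by simpa [hwu, hwu'] using hw
      exact Or.inr (hblock u hup huq hu w hwS hwW (hlu w hwS)))
  refine ⟨u, u', huS, huS'', huu', hQu, hQu', _, _, k6, Finset.subset_insert _ _, ?_, ?_⟩
  · exact Finset.card_insert_of_notMem fun e => h.notMem_edge huS u' (h.G_subset e)
  · have h1 := h.notMem_edge huS
    rw [Finset.card_insert_of_notMem, Finset.card_insert_of_notMem,
      Finset.card_insert_of_notMem (h1 p)]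
    · simp [h1 q, hne.symm, hup]
    · simp [h1 u', hup', huq', hup, huq]

end Config

theorem IsHullEdge.insert {S : Finset (ℝ × ℝ)} {p q v : ℝ × ℝ} (h : IsHullEdge S p q)
    (hv : 0 < orient p q v) : IsHullEdge (insert v S) p q where
  left_mem := Finset.mem_insert_of_mem h.left_mem
  right_mem := Finset.mem_insert_of_mem h.right_mem
  ne := h.ne
  orient_pos w hw hwp hwq := by
    rcases Finset.mem_insert.1 hw with rfl | hw
    exacts [hv, h.orient_pos w hw hwp hwq]

theorem eventually_orient_pos {a b v₀ : ℝ × ℝ} (h : 0 < orient a b v₀) :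
    ∀ᶠ v in 𝓝 v₀, 0 < orient a b v :=
  (continuous_orient continuous_const continuous_const continuous_id).continuousAt.eventually
    (lt_mem_nhds h)

namespace Config

variable {S W : Finset (ℝ × ℝ)} {G M T : Finset (Sym2 (ℝ × ℝ))}

/-- A new vertex beyond a hull edge of a saturated graph. -/
theorem exists_outer_full (h : Config S ∅ G ∅ G) {p q : ℝ × ℝ} (hpq : IsHullEdge S p q)
    (he : s(p, q) ∈ G) :
    ∃ v G', v ∉ S ∧ Config (insert v S) ∅ G' ∅ G' ∧ G'.card = G.card + 2 ∧
      IsHullEdge (insert v S) p v ∧ IsHullEdge (insert v S) v q ∧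
      s(p, v) ∈ G' ∧ s(v, q) ∈ G' := by
  obtain ⟨v, hv, hc, hcard, h1, h2, hb⟩ := h.exists_outer hpq
  have hc' := (hc.moveToG (e := s(v, p)) (by simp) (by simp)).moveToG
    (e := s(v, q)) (by simp) (by simp)
  refine ⟨v, _, hv, hc'.release rfl (by simp) (by simp) ?_, hcard, h1, h2, ?_, by simp⟩
  · intro w hw _ hwv
    have hwS := (Finset.mem_insert.1 hw).resolve_left hwv
    by_cases hwp : w = p
    · left; simp [hwp]
    by_cases hwq : w = q
    · left; simp [hwq]
    exact Or.inr ⟨p, q, by simp [he], h1.ne.symm, h2.ne, hwp, hwq, hb w hwS hwp hwq⟩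
  · rw [Sym2.eq_swap]; simp

/-- A new vertex close to a hull vertex of a saturated graph, joined to this vertex and to its two
hull neighbours. -/
theorem exists_cap_full (h : Config S ∅ G ∅ G) {x y z : ℝ × ℝ} (hxy : IsHullEdge S x y)
    (hyz : IsHullEdge S y z) (hxz : x ≠ z) (exy : s(x, y) ∈ G) (eyz : s(y, z) ∈ G) :
    ∃ v G', v ∉ S ∧ Config (insert v S) ∅ G' ∅ G' ∧ G'.card = G.card + 3 ∧
      IsHullEdge (insert v S) x v ∧ IsHullEdge (insert v S) v z ∧
      s(x, v) ∈ G' ∧ s(v, z) ∈ G' := by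
  have hx := hxy.left_mem
  have hy := hxy.right_mem
  have hz := hyz.right_mem
  have hpos : 0 < orient x y z := hxy.orient_pos z hz hxz.symm hyz.ne.symm
  have hev : ∀ᶠ v in 𝓝 y, (∀ w ∈ S, 0 < orient x y w → 0 < orient x v w) ∧
      (∀ w ∈ S, 0 < orient y z w → 0 < orient v z w) := by
    refine Eventually.and ?_ ?_ <;> rw [eventually_all_finset] <;> intro w _
    · by_cases h0 : 0 < orient x y w
      · have hcont : Continuous fun v => orient x v w :=
          continuous_orient continuous_const continuous_id continuous_const
        filter_upwards [hcont.continuousAt.eventually (lt_mem_nhds h0)] with v hv _ using hv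
      · exact Eventually.of_forall fun v h => absurd h h0
    · by_cases h0 : 0 < orient y z w
      · have hcont : Continuous fun v => orient v z w :=
          continuous_orient continuous_id continuous_const continuous_const
        filter_upwards [hcont.continuousAt.eventually (lt_mem_nhds h0)] with v hv _ using hv
      · exact Eventually.of_forall fun v h => absurd h h0
  obtain ⟨v, ⟨hv1, hv2⟩, hvx, hvz, hg⟩ := exists_near_corner S hpos hev
  have hvS : v ∉ S := notMem_of_orient_ne hx hy hxy.ne hg
  have nvx : v ≠ x := fun e => hvS (e ▸ hx)
  have nvy : v ≠ y := fun e => hvS (e ▸ hy)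
  have nvz : v ≠ z := fun e => hvS (e ▸ hz)
  have h1 : IsHullEdge (insert v S) x v := by
    refine ⟨Finset.mem_insert_of_mem hx, Finset.mem_insert_self _ _, nvx.symm, ?_⟩
    intro w hw hwx hwv
    have hwS := (Finset.mem_insert.1 hw).resolve_left hwv
    by_cases hwy : w = y
    · rw [hwy, orient_swap_right]; linarith
    · exact hv1 w hwS (hxy.orient_pos w hwS hwx hwy)
  have h2 : IsHullEdge (insert v S) v z := by
    refine ⟨Finset.mem_insert_self _ _, Finset.mem_insert_of_mem hz, nvz, ?_⟩
    intro w hw hwv hwz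
    have hwS := (Finset.mem_insert.1 hw).resolve_left hwv
    by_cases hwy : w = y
    · rw [hwy, orient_rotate, orient_swap_right]; linarith
    · exact hv2 w hwS (hyz.orient_pos w hwS hwy hwz)
  have hold : ∀ c d t (E : Finset (Sym2 (ℝ × ℝ))), s(c, d) ∈ insert s(v, t) E → v ≠ c → v ≠ d →
      s(c, d) ∈ E := by
    intro c d t E hcd h3 h4
    refine (Finset.mem_insert.1 hcd).resolve_left fun e => ?_
    rcases Sym2.eq_iff.1 e with ⟨rfl, -⟩ | ⟨-, rfl⟩
    exacts [h3 rfl, h4 rfl]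
  have k1 := (h.addPoint hvS hg).addEdge (a := v) (b := x) (by simp) (by simp [hx]) nvx (by
    intro c d hcd h3 h4 h5 h6
    exact disjoint_segment_of_orient_pos (p := x) (q := v) (by simp) (by simp)
      (h1.orient_pos c (Finset.mem_insert_of_mem (h.mem c d hcd)) h5.symm h3.symm)
      (h1.orient_pos d (Finset.mem_insert_of_mem (h.mem_right hcd)) h6.symm h4.symm))
  have k2 := k1.addEdge (a := v) (b := z) (by simp) (by simp [hz]) nvz (by
    intro c d hcd h3 h4 h5 h6
    replace hcd := hold c d _ _ hcd h3 h4
    exact disjoint_segment_of_orient_pos (p := v) (q := z) (by simp) (by simp)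
      (h2.orient_pos c (Finset.mem_insert_of_mem (h.mem c d hcd)) h3.symm h5.symm)
      (h2.orient_pos d (Finset.mem_insert_of_mem (h.mem_right hcd)) h4.symm h6.symm))
  have hsum : ∀ w ∈ S, w ≠ y → 0 < orient x y w + orient y z w := by
    intro w hw hwy
    by_cases hwx : w = x
    · rw [hwx, orient_self_left, zero_add]
      exact hyz.orient_pos x hx hxy.ne hxz
    · exact add_pos_of_pos_of_nonneg (hxy.orient_pos w hw hwx hwy) (hyz.orient_nonneg hw)
  have k3 := k2.addEdge (a := v) (b := y) (by simp) (by simp [hy]) nvy (by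
    intro c d hcd h3 h4 h5 h6
    replace hcd := hold c d _ _ (hold c d _ _ hcd h3 h4) h3 h4
    -- The zero line of this sum touches the hull only at `y`: the sum is negative at `v` and
    -- positive at every old vertex other than `y`.
    refine disjoint_segment_of_separated (f := fun w => orient x y w + orient y z w) ?_ ?_ ?_
      (hsum c (h.mem c d hcd) h5.symm) (hsum d (h.mem_right hcd) h6.symm)
    · intro c d s t hst
      simp only [orient_combo _ _ _ _ hst]; ring
    · linarith
    · simp)
  have k4 := ((k3.moveToG (e := s(v, x)) (by simp) (by simp)).moveToG (e := s(v, z)) (by simp)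
    (by simp)).moveToG (e := s(v, y)) (by simp) (by simp)
  refine ⟨v, _, hvS, k4.release rfl (by simp) (by simp) ?_, ?_, h1, h2, ?_, by simp⟩
  · intro w hw _ hwv
    have hwS := (Finset.mem_insert.1 hw).resolve_left hwv
    by_cases hwx : w = x
    · left; simp [hwx]
    by_cases hwy : w = y
    · left; simp [hwy]
    by_cases hwz : w = z
    · left; simp [hwz]
    right
    have p1 := hxy.orient_pos w hwS hwx hwy
    have p2 := hyz.orient_pos w hwS hwy hwz
    have p3 := hg y hy w hwS (Ne.symm hwy)
    rw [orient_swap_right] at p3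
    -- The side of the line `y v` on which `w` lies decides which of the two hull edges the segment
    -- `v w` crosses.
    rcases lt_or_gt_of_ne p3 with p3 | p3
    · exact ⟨y, z, by simp [eyz], nvy, nvz, hwy, hwz,
        segment_inter_segment_nonempty hvz p2 (by linarith) (hv2 w hwS p2)⟩
    · refine ⟨x, y, by simp [exy], nvx, nvy, hwx, hwy,
        segment_inter_segment_nonempty hvx p1 (hv1 w hwS p1) ?_⟩
      rw [orient_swap_left]
      linarith
  · have h3 := h.notMem_edge hvS
    rw [Finset.card_insert_of_notMem, Finset.card_insert_of_notMem,
      Finset.card_insert_of_notMem (h3 x)]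
    · simp [h3 z, hxz.symm, nvx]
    · simp [h3 y, hyz.ne, hxy.ne.symm, nvx, nvz]
  · rw [Sym2.eq_swap]; simp

/-- Pairs of adjacent vertices in the triangle `p q z` and beyond the hull edge `p z`. -/
theorem exists_fill (h : Config S W G M T) {p q z : ℝ × ℝ} (hp : p ∈ W) (hq : q ∈ W) (hz : z ∈ W)
    (hpq : s(p, q) ∈ G ∪ M) (hpz : s(p, z) ∈ G ∪ M) (h1 : IsHullEdge S p z)
    (h2 : IsHullEdge S z q) (hleft : ∀ w ∈ S, w ≠ p → w ≠ q → w ≠ z → 0 < orient p q w)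
    (hdeg : ∀ d, s(z, d) ∈ T → d = p ∨ d = q) :
    ∃ S' G' T', Config S' W G' M T' ∧ G ⊆ G' ∧ IsHullEdge S' z q ∧ S'.card = S.card + 4 ∧
      G'.card = G.card + 2 ∧ T'.card = T.card + 6 := by
  have hne : p ≠ q := h.ne p q (Finset.union_subset h.G_subset h.M_subset hpq)
  have hpzq : 0 < orient p z q := h1.orient_pos q h2.right_mem hne.symm h2.ne.symm
  have hzqp : 0 < orient z q p := h2.orient_pos p h1.left_mem h1.ne hne
  -- The pair inside the triangle comes first, while `z` has only the neighbours `p` and `q`. The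
  -- line of an edge at `z` then passes through `p` or `q`, so it does not separate them. The
  -- condition `Q` keeps `p z` and `z q` hull edges.
  obtain ⟨u, u', hu, hu', huu', hQu, hQu', G₁, T₁, k1, hG1, hGc, hTc⟩ :=
    h.exists_pair hp hq hpq (Q := fun v => 0 < orient p z v ∧ 0 < orient z q v)
      (fun w hw hwW => hleft w hw (fun e => hwW (e ▸ hp)) (fun e => hwW (e ▸ hq))
        (fun e => hwW (e ▸ hz)))
      (by
        have hnn : ∀ w ∈ S, w ≠ z → 0 ≤ orient p q w := by
          intro w hw hwz
          by_cases hwp : w = p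
          · simp [hwp]
          by_cases hwq : w = q
          · simp [hwq]
          exact (hleft w hw hwp hwq hwz).le
        intro c d hcd
        by_cases hcz : c = z
        · subst hcz
          right
          rcases hdeg d hcd with rfl | rfl <;> simp
        by_cases hdz : d = z
        · subst hdz
          right
          rcases hdeg c (by rwa [Sym2.eq_swap]) with rfl | rfl <;> simp
        exact Or.inl ⟨hnn c (h.mem c d hcd) hcz, hnn d (h.mem_right hcd) hdz⟩)
      ((eventually_orient_pos (by rw [orient_midpoint, orient_self_left]; linarith)).and
        (eventually_orient_pos (by rw [orient_midpoint, orient_self_right]; linarith)))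
  have h1' := (h1.insert hQu.1).insert hQu'.1
  have h2' := (h2.insert hQu.2).insert hQu'.2
  obtain ⟨o, o', ho, ho', hoo', hQo, hQo', G₂, T₂, k2, hG2, hGc2, hTc2⟩ :=
    k1.exists_pair hp hz (Finset.union_subset_union_left hG1 hpz)
      (Q := fun v => 0 < orient z q v)
      (fun w hw hwW => h1'.orient_pos w hw (fun e => hwW (e ▸ hp)) (fun e => hwW (e ▸ hz)))
      (fun c d hcd => Or.inl ⟨h1'.orient_nonneg (k1.mem c d hcd),
        h1'.orient_nonneg (k1.mem_right hcd)⟩)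
      (eventually_orient_pos (by rw [orient_midpoint, orient_self_left]; linarith))
  refine ⟨_, G₂, T₂, k2, hG1.trans hG2, (h2'.insert hQo).insert hQo', ?_, by omega, by omega⟩
  rw [Finset.card_insert_of_notMem (by simp [ho', hoo'.symm]), Finset.card_insert_of_notMem ho,
    Finset.card_insert_of_notMem (by simp [hu', huu'.symm]), Finset.card_insert_of_notMem hu]

end Config

/-! ### Saturated graphs without matching edges. -/

theorem exists_config_two : ∃ S G, ∃ p q : ℝ × ℝ, Config S ∅ G ∅ G ∧ IsHullEdge S p q ∧
    s(p, q) ∈ G ∧ S.card = 2 ∧ G.card = 1 := by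
  have hne : ((0, 0) : ℝ × ℝ) ≠ (1, 0) := by simp
  refine ⟨{(0, 0), (1, 0)}, {s((0, 0), (1, 0))}, (0, 0), (1, 0), ?_, ?_, by simp,
    Finset.card_pair hne, by simp⟩
  · refine ⟨?_, ?_, ?_, by simp, subset_rfl, by simp, by simp, ?_, by simp, by simp, ?_⟩
    · intro a ha b hb c hc hab hac hbc
      simp only [Finset.mem_insert, Finset.mem_singleton] at ha hb hc
      rcases ha with rfl | rfl <;> rcases hb with rfl | rfl <;> rcases hc with rfl | rfl <;>
        simp_all
    · intro a b hab
      rw [Finset.mem_singleton, Sym2.eq_iff] at hab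
      rcases hab with ⟨rfl, -⟩ | ⟨rfl, -⟩ <;> simp
    · intro a b hab
      rw [Finset.mem_singleton, Sym2.eq_iff] at hab
      rcases hab with ⟨rfl, rfl⟩ | ⟨rfl, rfl⟩
      exacts [hne, hne.symm]
    · intro a b c d hab hcd h1 h2 h3 h4
      rw [Finset.mem_singleton] at hab hcd
      rw [← hcd, Sym2.eq_iff] at hab
      rcases hab with ⟨rfl, rfl⟩ | ⟨rfl, rfl⟩
      exacts [absurd rfl h1, absurd rfl h2]
    · intro u hu v hv _ _ huv
      left
      simp only [Finset.mem_insert, Finset.mem_singleton] at hu hv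
      rw [Finset.mem_singleton, Sym2.eq_iff]
      rcases hu with rfl | rfl <;> rcases hv with rfl | rfl <;> simp_all
  · refine ⟨by simp, by simp, hne, ?_⟩
    intro w hw h1 h2
    simp_all

/-- Saturated graphs on `i + 2` points with `2 i + 1` edges. -/
theorem exists_config_polygon (i : ℕ) : ∃ S G, ∃ p q : ℝ × ℝ, Config S ∅ G ∅ G ∧
    IsHullEdge S p q ∧ s(p, q) ∈ G ∧ S.card = i + 2 ∧ G.card = 2 * i + 1 := by
  induction i with
  | zero => exact exists_config_two
  | succ i ih =>
    obtain ⟨S, G, p, q, h, hpq, he, hS, hG⟩ := ih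
    obtain ⟨v, G', hv, h', hG', -, h2, -, he2⟩ := h.exists_outer_full hpq he
    exact ⟨_, G', v, q, h', h2, he2, by rw [Finset.card_insert_of_notMem hv]; omega, by omega⟩

/-- Triangulations of `j + 3` points whose convex hull is a triangle. -/
theorem exists_config_triangle (j : ℕ) : ∃ S G, ∃ x y z : ℝ × ℝ, Config S ∅ G ∅ G ∧
    IsHullEdge S x y ∧ IsHullEdge S y z ∧ x ≠ z ∧ s(x, y) ∈ G ∧ s(y, z) ∈ G ∧
    S.card = j + 3 ∧ G.card = 3 * j + 3 := by
  induction j with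
  | zero =>
    obtain ⟨S, G, p, q, h, hpq, he, hS, hG⟩ := exists_config_two
    obtain ⟨v, G', hv, h', hG', h1, h2, he1, he2⟩ := h.exists_outer_full hpq he
    exact ⟨_, G', p, v, q, h', h1, h2, hpq.ne, he1, he2,
      by rw [Finset.card_insert_of_notMem hv]; omega, by omega⟩
  | succ j ih =>
    obtain ⟨S, G, x, y, z, h, hxy, hyz, hxz, exy, eyz, hS, hG⟩ := ih
    obtain ⟨v, G', hv, h', hG', h1, h2, he1, he2⟩ := h.exists_cap_full hxy hyz hxz exy eyz
    exact ⟨_, G', x, v, z, h', h1, h2, hxz, he1, he2,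
      by rw [Finset.card_insert_of_notMem hv]; omega, by omega⟩

/-- Saturated graphs on `i + j + 3` points with `2 i + 3 j + 3` edges. -/
theorem exists_config_triangulation (i j : ℕ) : ∃ S G, ∃ p q : ℝ × ℝ, Config S ∅ G ∅ G ∧
    IsHullEdge S p q ∧ s(p, q) ∈ G ∧ S.card = i + j + 3 ∧ G.card = 2 * i + 3 * j + 3 := by
  induction i with
  | zero =>
    obtain ⟨S, G, x, y, z, h, hxy, -, -, exy, -, hS, hG⟩ := exists_config_triangle j
    exact ⟨S, G, x, y, h, hxy, exy, by omega, by omega⟩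
  | succ i ih =>
    obtain ⟨S, G, p, q, h, hpq, he, hS, hG⟩ := ih
    obtain ⟨v, G', hv, h', hG', -, h2, -, he2⟩ := h.exists_outer_full hpq he
    exact ⟨_, G', v, q, h', h2, he2, by rw [Finset.card_insert_of_notMem hv]; omega, by omega⟩

/-! ### The chain of walls and its edge counts. -/

/-- There is a configuration with `n` points, `g` edges in `G`, `t` edges in `T`, and a matching
with `k` edges that covers the exempt points. -/
def HasConfig (n g t k : ℕ) : Prop :=
  ∃ S W G M T, Config S W G M T ∧ (∀ w ∈ W, ∃ w', s(w, w') ∈ M) ∧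
    S.card = n ∧ G.card = g ∧ T.card = t ∧ M.card = k

/-- As `HasConfig`, with a hull edge in `G` or `M` between exempt points. -/
def HasOpenConfig (n g t k : ℕ) : Prop :=
  ∃ S W G M T, ∃ p q : ℝ × ℝ, Config S W G M T ∧ (∀ w ∈ W, ∃ w', s(w, w') ∈ M) ∧
    IsHullEdge S p q ∧ p ∈ W ∧ q ∈ W ∧ s(p, q) ∈ G ∪ M ∧
    S.card = n ∧ G.card = g ∧ T.card = t ∧ M.card = k

/-- Two vertices are added outside a saturated polygon and matched with each other, so their four
edges need not be forced. -/
theorem hasOpenConfig_one (i : ℕ) : HasOpenConfig (i + 4) (2 * i + 1) (2 * i + 5) 1 := by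
  obtain ⟨S, G, x, y, h, hxy, he, hS, hG⟩ := exists_config_polygon i
  obtain ⟨p, hp, k1, hc1, -, h2, -⟩ := h.exists_outer hxy
  obtain ⟨q, hq, k2, hc2, h3, -, -⟩ := k1.exists_outer h2
  have k3 := k2.moveToM (a := q) (b := p) (by simp)
    (fun e => k1.notMem_edge hq p (k1.G_subset e)) (by simp) (by simp) (by simp) (by simp)
  refine ⟨_, _, _, _, _, p, q, k3, ?_, h3, by simp, by simp, ?_, ?_, hG, by omega, by simp⟩
  · intro w hw
    simp only [Finset.mem_insert, Finset.notMem_empty, or_false] at hw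
    rcases hw with rfl | rfl
    · exact ⟨p, by simp⟩
    · exact ⟨q, by simp [Sym2.eq_swap]⟩
  · simp [Sym2.eq_swap]
  · rw [Finset.card_insert_of_notMem hq, Finset.card_insert_of_notMem hp]; omega

theorem HasOpenConfig.succ {n g t k : ℕ} (h : HasOpenConfig n g t k) :
    HasOpenConfig (n + 10) (g + 7) (t + 16) (k + 1) := by
  obtain ⟨S, W, G, M, T, p, q, h, hW, hpq, hp, hq, he, hS, hG, hT, hM⟩ := h
  obtain ⟨z, hz, a1, hTz, hpz, hzq, -⟩ := h.exists_outer hpq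
  have hzT := h.notMem_edge hz
  have hzM : ∀ x, s(z, x) ∉ M := fun x e => hzT x (h.M_subset e)
  have hzG : ∀ x, s(z, x) ∉ G := fun x e => hzT x (h.G_subset e)
  have a2 := (a1.moveToG (e := s(z, p)) (by simp) (hzM p)).moveToG (e := s(z, q)) (by simp) (hzM q)
  obtain ⟨S₁, G₁, T₁, a3, hG₁, hzq₁, hS₁c, hG₁c, hT₁c⟩ := a2.exists_fill (p := p) (q := q) (z := z)
    (by simp [hp]) (by simp [hq]) (by simp)
    (Finset.union_subset_union_left
      ((Finset.subset_insert _ _).trans (Finset.subset_insert _ _)) he)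
    (by rw [Sym2.eq_swap]; simp) hpz hzq
    (fun w hw hwp hwq hwz => hpq.orient_pos w ((Finset.mem_insert.1 hw).resolve_left hwz) hwp hwq)
    (fun d hd => by
      rw [Finset.mem_insert, Finset.mem_insert, Sym2.congr_right, Sym2.congr_right] at hd
      rcases hd with hd | hd | hd
      exacts [Or.inr hd, Or.inl hd, absurd hd (hzT d)])
  have hzqG : s(z, q) ∈ G₁ := hG₁ (by simp)
  obtain ⟨y, hy, b1, hTy, hzy, hyq, -⟩ := a3.exists_outer hzq₁
  have hyT := a3.notMem_edge hy
  have hyM : ∀ x, s(y, x) ∉ M := fun x e => hyT x (a3.M_subset e)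
  have hyG : ∀ x, s(y, x) ∉ G₁ := fun x e => hyT x (a3.G_subset e)
  -- The wall `y z` is the new matching edge. It covers both new exempt vertices and saves a forced
  -- edge.
  have b2 := (b1.moveToG (e := s(y, q)) (by simp) (hyM q)).moveToM (a := y) (b := z) (by simp)
    (by simp [hyG, hzq.ne, hyq.ne]) (by simp) (by simp) hyM hzM
  obtain ⟨S₂, G₂, T₂, b3, hG₂, hyq₂, hS₂c, hG₂c, hT₂c⟩ := b2.exists_fill (p := z) (q := q) (z := y)
    (by simp) (by simp [hq]) (by simp) (by simp [hzqG]) (by rw [Sym2.eq_swap]; simp) hzy hyq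
    (fun w hw hwp hwq hwz => hzq₁.orient_pos w ((Finset.mem_insert.1 hw).resolve_left hwz) hwp hwq)
    (fun d hd => by
      rw [Finset.mem_insert, Finset.mem_insert, Sym2.congr_right, Sym2.congr_right] at hd
      rcases hd with hd | hd | hd
      exacts [Or.inr hd, Or.inl hd, absurd hd (hyT d)])
  refine ⟨S₂, _, G₂, _, T₂, y, q, b3, ?_, hyq₂, by simp, by simp [hq],
    Finset.mem_union_left _ (hG₂ (by simp)), ?_, ?_, by omega, ?_⟩
  · intro w hw
    rw [Finset.mem_insert, Finset.mem_insert] at hw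
    rcases hw with rfl | rfl | hw
    · exact ⟨z, by simp⟩
    · exact ⟨y, by simp [Sym2.eq_swap]⟩
    · obtain ⟨w', hw'⟩ := hW w hw
      exact ⟨w', by simp [hw']⟩
  · rw [Finset.card_insert_of_notMem hy] at hS₂c
    rw [Finset.card_insert_of_notMem hz] at hS₁c
    omega
  · rw [Finset.card_insert_of_notMem (hyG q)] at hG₂c
    rw [Finset.card_insert_of_notMem (by simp [hzG, hpq.ne.symm, hpz.ne.symm]),
      Finset.card_insert_of_notMem (hzG p)] at hG₁c
    omega
  · rw [Finset.card_insert_of_notMem (hyM z), hM]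

/-- The open hull wall can hide one last pair. This raises 2n - |G| by 3, from 13k + 7 to 13k + 10
for a chain with k + 1 matching edges, which is the largest value of 2n - m with ceiling k + 1. -/
theorem HasOpenConfig.close {n g t k : ℕ} (h : HasOpenConfig n g t k) :
    HasConfig (n + 2) (g + 1) (t + 3) k := by
  obtain ⟨S, W, G, M, T, p, q, h, hW, hpq, hp, hq, he, hS, hG, hT, hM⟩ := h
  obtain ⟨u, u', hu, hu', huu', -, -, G', T', h', -, hG', hT'⟩ := h.exists_pair hp hq he
    (fun w hw hwW => hpq.orient_pos w hw (fun e => hwW (e ▸ hp)) (fun e => hwW (e ▸ hq)))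
    (fun c d hcd => Or.inl ⟨hpq.orient_nonneg (h.mem c d hcd),
      hpq.orient_nonneg (h.mem_right hcd)⟩)
    (Q := fun _ => True) (Eventually.of_forall fun _ => trivial)
  refine ⟨_, W, G', M, T', h', hW, ?_, by omega, by omega, hM⟩
  rw [Finset.card_insert_of_notMem (by simp [hu', huu'.symm]), Finset.card_insert_of_notMem hu, hS]

theorem hasOpenConfig (i k : ℕ) :
    HasOpenConfig (i + 10 * k + 4) (2 * i + 7 * k + 1) (2 * i + 16 * k + 5) (k + 1) := by
  induction k with
  | zero => exact hasOpenConfig_one i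
  | succ k ih =>
    convert ih.succ using 1 <;> ring

/-- An edge of a triangulation can be taken as the matching. -/
theorem hasConfig_triangulation (i j : ℕ) :
    HasConfig (i + j + 3) (2 * i + 3 * j + 2) (2 * i + 3 * j + 3) 1 := by
  obtain ⟨S, G, p, q, h, hpq, he, hS, hG⟩ := exists_config_triangulation i j
  have hun : G.erase s(p, q) ∪ {s(p, q)} = G := by
    rw [Finset.union_comm, ← Finset.insert_eq, Finset.insert_erase he]
  refine ⟨S, {p, q}, G.erase s(p, q), {s(p, q)}, G, ?_, ?_, hS, ?_, hG, by simp⟩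
  · refine ⟨h.orient_ne, h.mem, h.ne, ?_, Finset.erase_subset _ _, by simpa using he, by simp,
      h.noncrossing, ?_, ?_, ?_⟩
    · simp [Finset.insert_subset_iff, hpq.left_mem, hpq.right_mem]
    · intro a b c hb hc
      rw [Finset.mem_singleton] at hb hc
      exact Sym2.congr_right.1 (hb.trans hc.symm)
    · intro a b hab
      rw [Finset.mem_singleton, Sym2.eq_iff] at hab
      rcases hab with ⟨rfl, -⟩ | ⟨rfl, -⟩ <;> simp
    · intro u hu v hv huW hvW huv
      rw [hun]
      refine (h.saturated u hu v hv (by simp) (by simp) huv).imp (fun h => ?_)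
        (fun h => by simpa using h)
      refine Finset.mem_erase.2 ⟨fun e => huW ?_, h⟩
      rcases Sym2.eq_iff.1 e with ⟨rfl, -⟩ | ⟨rfl, -⟩ <;> simp
  · intro w hw
    rw [Finset.mem_insert, Finset.mem_singleton] at hw
    rcases hw with rfl | rfl
    · exact ⟨q, by simp⟩
    · exact ⟨p, by simp [Sym2.eq_swap]⟩
  · rw [Finset.card_erase_of_mem he]; omega

/-! ### From configurations to geometric graphs. -/

/-- The graph on `V` whose edges are drawn, by `pos`, as the edges of `E`. -/
def drawnGraph {V : Type*} (pos : V → ℝ × ℝ) (E : Finset (Sym2 (ℝ × ℝ))) : SimpleGraph V :=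
  SimpleGraph.fromEdgeSet (Sym2.map pos ⁻¹' E)

theorem drawnGraph_adj {V : Type*} {pos : V → ℝ × ℝ} {E : Finset (Sym2 (ℝ × ℝ))} {a b : V} :
    (drawnGraph pos E).Adj a b ↔ s(pos a, pos b) ∈ E ∧ a ≠ b := by
  simp [drawnGraph]

theorem drawnGraph_union {V : Type*} (pos : V → ℝ × ℝ) (E F : Finset (Sym2 (ℝ × ℝ))) :
    drawnGraph pos (E ∪ F) = drawnGraph pos E ⊔ drawnGraph pos F := by
  ext a b
  simp only [SimpleGraph.sup_adj, drawnGraph_adj, Finset.mem_union]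
  tauto

namespace Config

variable {S W : Finset (ℝ × ℝ)} {G M T : Finset (Sym2 (ℝ × ℝ))} {V : Type*} {pos : V → ℝ × ℝ}

theorem isNoncrossing_drawnGraph (h : Config S W G M T) (hpos : Function.Injective pos)
    (hS : ∀ v, pos v ∈ S) {E : Finset (Sym2 (ℝ × ℝ))} (hE : E ⊆ T) :
    IsNoncrossing (drawnGraph pos E) pos := by
  have key : ∀ a b d : V, a ≠ b → a ≠ d → b ≠ d → ∀ x,
      x ∈ segment ℝ (pos a) (pos b) → x ∈ segment ℝ (pos a) (pos d) → x = pos a := by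
    intro a b d hab had hbd x hx hx'
    exact segment_inter_segment_subset (h.orient_ne _ (hS a) _ (hS b) _ (hS d) (hpos.ne hab)
      (hpos.ne had) (hpos.ne hbd)) ⟨hx, hx'⟩
  rintro a b c d hab hcd hne x ⟨hx, hx'⟩
  rw [drawnGraph_adj] at hab hcd
  by_cases hac : a = c
  · subst hac
    have hbd : b ≠ d := by rintro rfl; exact hne rfl
    exact ⟨a, by simp, (key a b d hab.2 hcd.2 hbd x hx hx').symm⟩
  by_cases had : a = d
  · subst had
    have hbc : b ≠ c := by rintro rfl; exact hne Sym2.eq_swap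
    rw [segment_symm] at hx'
    exact ⟨a, by simp, (key a b c hab.2 hcd.2.symm hbc x hx hx').symm⟩
  by_cases hbc : b = c
  · subst hbc
    rw [segment_symm] at hx
    exact ⟨b, by simp, (key b a d hab.2.symm hcd.2 had x hx hx').symm⟩
  by_cases hbd : b = d
  · subst hbd
    rw [segment_symm] at hx hx'
    exact ⟨b, by simp, (key b a c hab.2.symm hcd.2.symm hac x hx hx').symm⟩
  exact absurd hx' (Set.disjoint_left.1 (h.noncrossing _ _ _ _ (hE hab.1) (hE hcd.1) (hpos.ne hac)
    (hpos.ne had) (hpos.ne hbc) (hpos.ne hbd)) hx)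

theorem ncard_edgeSet_drawnGraph (h : Config S W G M T) (hpos : Function.Injective pos)
    (hS : ∀ v ∈ S, v ∈ Set.range pos) {E : Finset (Sym2 (ℝ × ℝ))} (hE : E ⊆ T) :
    (drawnGraph pos E).edgeSet.ncard = E.card := by
  rw [← Set.ncard_image_of_injective _ (Sym2.map.injective hpos), ← Set.ncard_coe_finset]
  congr 1
  ext e
  constructor
  · rintro ⟨f, hf, rfl⟩
    induction f with
    | _ a b => exact (drawnGraph_adj.1 hf).1
  · intro he
    induction e with
    | _ x y =>
      have he' : s(x, y) ∈ T := hE he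
      obtain ⟨a, rfl⟩ := hS x (h.mem _ _ he')
      obtain ⟨b, rfl⟩ := hS y (h.mem_right he')
      exact ⟨s(a, b), drawnGraph_adj.2 ⟨he, fun e => h.ne _ _ he' (congrArg pos e)⟩, rfl⟩

end Config

theorem HasConfig.exists_geometricGraph {n g t k m : ℕ} (h : HasConfig n g t k) (hg : g ≤ m)
    (ht : m + k ≤ t) : ∃ G : GeometricGraph (Fin n), G.numEdges = m ∧
      ∃ M : SimpleGraph (Fin n), G.IsMaximalCompatibleMatching M ∧ M.edgeSet.ncard = k := by
  obtain ⟨S, W, G, M, T, h, hW, hS, hG, hT, hM⟩ := h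
  -- Optional edges are added to `G` until there are exactly `m`.
  obtain ⟨E, hGE, hET, hE⟩ := Finset.exists_subsuperset_card_eq
    (Finset.subset_sdiff.2 ⟨h.G_subset, h.disjoint⟩) (hG.trans_le hg)
    (show m ≤ (T \ M).card by rw [Finset.card_sdiff_of_subset h.M_subset]; omega)
  rw [Finset.subset_sdiff] at hET
  set pos : Fin n → ℝ × ℝ := fun i => ((S.equivFinOfCardEq hS).symm i : ℝ × ℝ) with hposdef
  have hpos : Function.Injective pos :=
    Subtype.val_injective.comp (S.equivFinOfCardEq hS).symm.injective
  have hposS : ∀ i, pos i ∈ S := fun i => ((S.equivFinOfCardEq hS).symm i).2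
  have hrange : ∀ v ∈ S, v ∈ Set.range pos := fun v hv =>
    ⟨S.equivFinOfCardEq hS ⟨v, hv⟩, by simp [hposdef]⟩
  have hEMT : E ∪ M ⊆ T := Finset.union_subset hET.1 h.M_subset
  refine ⟨⟨drawnGraph pos E, pos, hpos, fun u v w huv huw hvw => not_collinear_of_orient_ne_zero
    (h.orient_ne _ (hposS u) _ (hposS v) _ (hposS w) (hpos.ne huv) (hpos.ne huw) (hpos.ne hvw)),
    h.isNoncrossing_drawnGraph hpos hposS hET.1⟩, ?_, drawnGraph pos M, ⟨⟨?_, ?_, ?_⟩, ?_⟩, ?_⟩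
  · exact (h.ncard_edgeSet_drawnGraph hpos hrange hET.1).trans hE
  · intro a b c hab hac
    exact hpos (h.matching _ _ _ (drawnGraph_adj.1 hab).1 (drawnGraph_adj.1 hac).1)
  · rw [SimpleGraph.disjoint_left]
    intro a b hab hab'
    exact Finset.disjoint_left.1 hET.2 (drawnGraph_adj.1 hab).1 (drawnGraph_adj.1 hab').1
  · change IsNoncrossing (drawnGraph pos E ⊔ drawnGraph pos M) pos
    rw [← drawnGraph_union]
    exact h.isNoncrossing_drawnGraph hpos hposS hEMT
  · intro M' hM' hMM'
    -- Exempt vertices already have a partner in `M`, so a larger matching can only gain edges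
    -- between vertices outside `W`; saturation rules these out.
    have hcov : ∀ a b, M'.Adj a b → pos a ∈ W → (drawnGraph pos M).Adj a b := by
      intro a b hab ha
      obtain ⟨w, hw⟩ := hW _ ha
      obtain ⟨c, rfl⟩ := hrange w (h.mem_right (h.M_subset hw))
      have hac : (drawnGraph pos M).Adj a c :=
        drawnGraph_adj.2 ⟨hw, fun e => h.ne _ _ (h.M_subset hw) (e ▸ rfl)⟩
      rwa [hM'.matching a b c hab (hMM' hac)]
    intro a b hab
    by_cases ha : pos a ∈ W
    · exact hcov a b hab ha
    by_cases hb : pos b ∈ W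
    · exact (hcov b a hab.symm hb).symm
    exfalso
    rcases h.saturated _ (hposS a) _ (hposS b) ha hb (hpos.ne hab.ne) with
      he | ⟨c, d, hcd, h1, h2, h3, h4, x, hx, hx'⟩
    · exact (SimpleGraph.disjoint_left.1 hM'.disjoint a b)
        (drawnGraph_adj.2 ⟨hGE he, hab.ne⟩) hab
    · replace hcd := Finset.union_subset_union_left hGE hcd
      obtain ⟨c, rfl⟩ := hrange c (h.mem c d (hEMT hcd))
      obtain ⟨d, rfl⟩ := hrange d (h.mem_right (hEMT hcd))
      have hadj : (drawnGraph pos E ⊔ M').Adj c d := by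
        have : (drawnGraph pos (E ∪ M)).Adj c d :=
          drawnGraph_adj.2 ⟨hcd, fun e => h.ne _ _ (hEMT hcd) (e ▸ rfl)⟩
        rw [drawnGraph_union] at this
        exact sup_le_sup_left hMM' _ this
      have hac : a ≠ c := fun e => h1 (e ▸ rfl)
      have had : a ≠ d := fun e => h2 (e ▸ rfl)
      have hbc : b ≠ c := fun e => h3 (e ▸ rfl)
      have hbd : b ≠ d := fun e => h4 (e ▸ rfl)
      obtain ⟨y, ⟨hy1, hy2⟩, -⟩ := hM'.noncrossing a b c d (Or.inr hab) hadj
        (fun e => by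
          rcases Sym2.eq_iff.1 e with ⟨e, -⟩ | ⟨e, -⟩
          exacts [hac e, had e]) ⟨hx, hx'⟩
      simp only [Set.mem_insert_iff, Set.mem_singleton_iff] at hy1 hy2
      rcases hy1 with rfl | rfl <;> rcases hy2 with rfl | rfl
      exacts [hac rfl, had rfl, hbc rfl, hbd rfl]
  · exact (h.ncard_edgeSet_drawnGraph hpos hrange h.M_subset).trans hM

/-! ### Choice of parameters and the density bound. -/

theorem exists_maximalCompatibleMatching_of_le (n m : ℕ)
    (h1 : (7 * (n : ℚ) + 95) / 10 ≤ (m : ℚ)) (h2 : m ≤ 2 * n + 2)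
    (h3 : (m : ℤ) ≤ 3 * (n : ℤ) - 7) :
    ∃ G : GeometricGraph (Fin n), G.numEdges = m ∧
      ∃ M : SimpleGraph (Fin n), G.IsMaximalCompatibleMatching M ∧
        (M.edgeSet.ncard : ℤ) = ⌈(2 * (n : ℚ) - (m : ℚ) + 3) / 13⌉ := by
  set K : ℤ := ⌈(2 * (n : ℚ) - (m : ℚ) + 3) / 13⌉ with hK
  have hK1 : 2 * (n : ℤ) - m + 3 ≤ 13 * K := by
    have := Int.le_ceil ((2 * (n : ℚ) - (m : ℚ) + 3) / 13)
    rw [← hK, div_le_iff₀ (by norm_num)] at this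
    have h : 2 * (n : ℚ) - m + 3 ≤ 13 * K := by linarith
    exact_mod_cast h
  have hK2 : 13 * K < 2 * (n : ℤ) - m + 16 := by
    have := Int.ceil_lt_add_one ((2 * (n : ℚ) - (m : ℚ) + 3) / 13)
    rw [← hK, ← sub_lt_iff_lt_add, lt_div_iff₀ (by norm_num)] at this
    have h : 13 * (K : ℚ) < 2 * (n : ℚ) - m + 16 := by linarith
    exact_mod_cast h
  have h1' : 7 * n + 95 ≤ 10 * m := by
    rw [div_le_iff₀ (by norm_num)] at h1
    have h : 7 * (n : ℚ) + 95 ≤ 10 * m := by linarith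
    exact_mod_cast h
  -- The bound `m ≤ 2 * n + 2` makes the ceiling at least 1.
  obtain ⟨k, hk⟩ : ∃ k : ℕ, K = k + 1 := ⟨(K - 1).toNat, by omega⟩
  clear_value K
  subst hk
  by_cases hcase : k = 0 ∧ 2 * n ≤ m + 4
  · obtain ⟨rfl, hm⟩ := hcase
    obtain ⟨j, hj⟩ : ∃ j, j + 2 * n = m + 4 := ⟨m + 4 - 2 * n, by omega⟩
    -- Here i = 3n - m - 7, which is where `h3` enters.
    obtain ⟨i, rfl⟩ : ∃ i, n = i + j + 3 := ⟨n - j - 3, by omega⟩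
    obtain ⟨G, hG, M, hM, hMk⟩ :=
      (hasConfig_triangulation i j).exists_geometricGraph (m := m) (by omega) (by omega)
    exact ⟨G, hG, M, hM, by rw [hMk]; norm_num⟩
  -- The upper bound on the ceiling and `h1'` give 10(k + 1) < n + 5, that is n ≥ 10k + 6; the
  -- constant 95 is what this requires.
  · obtain ⟨i, rfl⟩ : ∃ i, n = i + 10 * k + 4 + 2 := ⟨n - (10 * k + 6), by omega⟩
    obtain ⟨G, hG, M, hM, hMk⟩ :=
      (hasOpenConfig i k).close.exists_geometricGraph (m := m) (by omega) (by omega)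
    exact ⟨G, hG, M, hM, by rw [hMk]; norm_num⟩

theorem mmDensity_le {d : ℝ} (h1 : 7 / 10 < d) (h2 : d < 2) :
    GeometricGraph.mmDensity d ≤ (((2 - d) / 13 : ℝ) : EReal) := by
  have hlim : Tendsto (fun n : ℕ => (((2 - d) / 13 + 2 / n : ℝ) : EReal)) atTop
      (𝓝 (((2 - d) / 13 : ℝ) : EReal)) := by
    refine (continuous_coe_real_ereal.tendsto _).comp ?_
    simpa using (tendsto_const_nhds (x := (2 - d) / 13)).add
      (tendsto_const_div_atTop_nhds_zero_nat 2)
  rw [← hlim.liminf_eq]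
  refine liminf_le_liminf ?_
  -- As m > dn - 1, the condition 10m ≥ 7n + 95 follows from (d - 7/10)n ≥ 21/2. For n ≥ 7 also m ≤
  -- 2n ≤ 3n - 7.
  obtain ⟨N, hN⟩ := exists_nat_gt (21 / 2 / (d - 7 / 10))
  filter_upwards [eventually_ge_atTop (max N 7)] with n hn
  have hnN : N ≤ n := le_trans (le_max_left _ _) hn
  have hn7 : 7 ≤ n := le_trans (le_max_right _ _) hn
  have hn0 : (0 : ℝ) < n := by exact_mod_cast (by omega : 0 < n)
  have hbig : 21 / 2 ≤ (d - 7 / 10) * n := by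
    rw [div_lt_iff₀ (by linarith)] at hN
    have : (N : ℝ) ≤ n := by exact_mod_cast hnN
    nlinarith
  have hdn : 0 ≤ d * n := by nlinarith
  set m := ⌊d * n⌋₊ with hm
  have hm1 : (m : ℝ) ≤ d * n := Nat.floor_le hdn
  have hm2 : d * n < m + 1 := Nat.lt_floor_add_one _
  have hm3 : m ≤ 2 * n := by
    have : (m : ℝ) ≤ 2 * n := by nlinarith
    exact_mod_cast this
  obtain ⟨G, hG, M, hM, hMk⟩ := exists_maximalCompatibleMatching_of_le n m (by
    have : 7 * (n : ℝ) + 95 ≤ m * 10 := by linarith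
    rw [div_le_iff₀ (by norm_num)]
    exact_mod_cast this) (by omega) (by omega)
  have hmem : G ∈ GeometricGraph.family d n := by
    change (G.numEdges : ℝ) ≤ d * n
    rwa [hG]
  refine (iInf₂_le G hmem).trans ?_
  rw [EReal.coe_le_coe_iff]
  have hmm : G.mm ≤ M.edgeSet.ncard := Nat.sInf_le ⟨M, hM, rfl⟩
  have hceil := (Int.ceil_lt_add_one ((2 * (n : ℚ) - (m : ℚ) + 3) / 13)).le
  rw [← hMk] at hceil
  have hceil' : (M.edgeSet.ncard : ℝ) ≤ (2 * (n : ℝ) - m + 3) / 13 + 1 := by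
    have := (Rat.cast_le (K := ℝ)).2 hceil
    push_cast at this
    exact this
  have hmm' : (G.mm : ℝ) ≤ M.edgeSet.ncard := by exact_mod_cast hmm
  -- Rounding `m` and the ceiling costs at most 4/13 + 1, which is below the 2 allowed in `hlim`.
  rw [div_le_iff₀ hn0, add_mul, div_mul_cancel₀ _ hn0.ne']
  linarith

theorem lemma2 :
    (∀ n m : ℕ, 5 ≤ n → (7 * (n : ℚ) + 95) / 10 ≤ (m : ℚ) → m ≤ 2 * n + 2 →
      (m : ℤ) ≤ 3 * (n : ℤ) - 7 →
      ∃ G : GeometricGraph (Fin n), G.numEdges = m ∧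
        ∃ M : SimpleGraph (Fin n), G.IsMaximalCompatibleMatching M ∧
          (M.edgeSet.ncard : ℤ) = ⌈(2 * (n : ℚ) - (m : ℚ) + 3) / 13⌉) ∧
    (∀ d : ℝ, 7 / 10 < d → d < 2 →
      GeometricGraph.mmDensity d ≤ (((2 - d) / 13 : ℝ) : EReal)) :=
  ⟨fun n m _ => exists_maximalCompatibleMatching_of_le n m, fun _ => mmDensity_le⟩
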